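/- Proposition. For $k\in\mathbb N$ and $\xi\in[-1,1]$ let $P^0_k(\xi)=\frac{1}{2^k k!}\frac{d^k}{d\xi^k}(\xi^2-1)^k$ be the Legendre polynomial and $P^1_k(\xi)=\sqrt{1-\xi^2}\,\frac{d}{d\xi}P^0_k(\xi)$. For $x\ge 0$ put $$\mathcal P_k(x)={}_2F_1\!\left(\tfrac k2,\tfrac{k+1}2;\tfrac{2k+3}2;-x^2\right)\ (k\ge1),\qquad \mathcal S_k(x)={}_2F_1\!\left(\tfrac k2,\tfrac{k+1}2;\tfrac{2k+1}2;-x^2\right)\ (k\ge2),$$ where ${}_2F_1(a,b;c;\cdot)$ denotes the Gauss hypergeometric function, analytically continued to $(-\infty,1)$. Let $\ell>0$ and let $(\rho_k)_{k\ge1}$, $(\sigma_k)_{k\ge2}$ be sequences of real numbers, non-zero for all sufficiently large $k$, such that the limits below exist and satisfy $$\lim_{k\to\infty}\left|\frac{\sigma_{k+1}}{\sigma_k}\right|<\frac1{2\ell},\qquad \lim_{k\to\infty}\left|\frac{\rho_{k+1}}{\rho_k}\right|<\frac1{2\ell}.$$ Then, for all $x\in[0,\infty)$ and all $\xi\in[-1,1]$,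 the infinite sums defining the gauge functions (with $r=\ell x$) $$\alpha(r,\xi)=\sum_{k=1}^\infty \rho_k\,\mathcal P_k(x)\,P^0_k(\xi)\,(x\ell)^k,\qquad \omega(r,\xi)=\sqrt{1-\xi^2}+\sum_{k=2}^\infty \sigma_k\,\mathcal S_k(x)\,P^1_{k-1}(\xi)\,(x\ell)^k$$ converge absolutely. -/

import Mathlib

open Real Set MeasureTheory Filter Topology

namespace AdSDyon

/-- The Gauss hypergeometric function `₂F₁(a, b; c; z)` for real `z < 1` and `0 < b < c`, given by
Euler's integral. Mathlib's `₂F₁` is the power series only, which is junk for `|z| > 1`. The two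
theorems `hyp2F1_eq` and `hyp2F1_analyticOnNhd` below show that this function agrees with the power
series on `(-1, 1)` and is real-analytic on `(-∞, 1)`: it is the analytic continuation. -/
noncomputable def hyp2F1 (a b c z : ℝ) : ℝ :=
  Real.Gamma c / (Real.Gamma b * Real.Gamma (c - b)) *
    ∫ t in (0:ℝ)..1, t ^ (b - 1) * (1 - t) ^ (c - b - 1) * (1 - z * t) ^ (-a)

theorem beta_aux (u v : ℝ) (hu : 0 < u) (hv : 0 < v) :
    IntervalIntegrable (fun t : ℝ => t ^ (u - 1) * (1 - t) ^ (v - 1)) volume 0 1 ∧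
    ∫ t in (0:ℝ)..1, t ^ (u - 1) * (1 - t) ^ (v - 1) =
      Real.Gamma u * Real.Gamma v / Real.Gamma (u + v) := by
  have h1 : ∀ t ∈ Ioc (0:ℝ) 1, (((t ^ (u - 1) * (1 - t) ^ (v - 1) : ℝ)) : ℂ) =
      (t : ℂ) ^ ((u:ℂ) - 1) * (1 - (t:ℂ)) ^ ((v:ℂ) - 1) := by
    intro t ht
    rw [Complex.ofReal_mul, Complex.ofReal_cpow ht.1.le, Complex.ofReal_cpow (by linarith [ht.2])]
    push_cast; rfl
  have h2 := Complex.betaIntegral_convergent (u := u) (v := v) (by simpa) (by simpa)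
  constructor
  · rw [intervalIntegrable_iff_integrableOn_Ioc_of_le zero_le_one] at h2 ⊢
    have h3 : IntegrableOn (fun t : ℝ => ((t ^ (u - 1) * (1 - t) ^ (v - 1) : ℝ) : ℂ)) (Ioc 0 1) :=
      h2.congr_fun (fun t ht => (h1 t ht).symm) measurableSet_Ioc
    exact (by simpa using h3.re : Integrable _ _)
  · have := ProbabilityTheory.beta_eq_betaIntegralReal u v hu hv
    rw [ProbabilityTheory.beta] at this
    rw [this, Complex.betaIntegral]
    have h4 : ∫ x in (0:ℝ)..1, (x : ℂ) ^ ((u:ℂ) - 1) * (1 - (x:ℂ)) ^ ((v:ℂ) - 1) =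
       ∫ x in (0:ℝ)..1, ((x ^ (u - 1) * (1 - x) ^ (v - 1) : ℝ) : ℂ) := by
      apply intervalIntegral.integral_congr_ae
      refine Filter.Eventually.of_forall fun t ht => ?_
      rw [uIoc_of_le zero_le_one] at ht
      exact (h1 t ht).symm
    rw [h4, intervalIntegral.integral_ofReal, Complex.ofReal_re]

theorem poch_eq (z : ℝ) (hz : 0 < z) (n : ℕ) :
    Real.Gamma (z + n) = (ascPochhammer ℝ n).eval z * Real.Gamma z := by
  induction n with
  | zero => simp
  | succ n ih =>
    rw [ascPochhammer_succ_right]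
    push_cast
    rw [← add_assoc, Real.Gamma_add_one (by positivity), ih]
    simp; ring

theorem binom_hasSum (a w : ℝ) (hw : |w| < 1) :
    HasSum (fun n : ℕ => ((ascPochhammer ℝ n).eval a / n.factorial) * w ^ n) ((1 - w) ^ (-a)) ∧
    Summable (fun n : ℕ => |(ascPochhammer ℝ n).eval a / n.factorial| * |w| ^ n) := by
  have h := Real.one_div_one_sub_rpow_hasFPowerSeriesOnBall_zero a
  have hc : ∀ n : ℕ, Ring.choose (a + n - 1) n = (ascPochhammer ℝ n).eval a / n.factorial := by
    intro n
    rw [← Ring.multichoose_eq, eq_div_iff (by positivity)]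
    have := Ring.factorial_nsmul_multichoose_eq_ascPochhammer a n
    rw [Polynomial.ascPochhammer_smeval_eq_eval] at this
    rw [← this, nsmul_eq_mul, mul_comm]
  have hb : w ∈ Metric.eball (0:ℝ) 1 := by
    simpa [enorm_eq_nnnorm, ← NNReal.coe_lt_coe] using hw
  constructor
  · have := h.hasSum hb
    simp only [FormalMultilinearSeries.ofScalars_apply_eq, hc, zero_add, smul_eq_mul] at this
    rwa [one_div, ← Real.rpow_neg (by linarith [(abs_lt.1 hw).2])] at this
  · have := FormalMultilinearSeries.summable_norm_apply _ (Metric.eball_subset_eball h.r_le hb)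
    simpa only [FormalMultilinearSeries.ofScalars_apply_eq, hc, smul_eq_mul, norm_mul, norm_pow, Real.norm_eq_abs] using this

/-- On `(-1, 1)` the function is the sum of the hypergeometric series. -/
theorem hyp2F1_eq (a b c z : ℝ) (hb : 0 < b) (hbc : b < c) (hz : |z| < 1) :
    hyp2F1 a b c z = ₂F₁ a b c z := by
  have hv : 0 < c - b := sub_pos.2 hbc
  set p : ℕ → ℝ := fun n => (ascPochhammer ℝ n).eval a / n.factorial with hp
  have hint := (beta_aux b (c - b) hb hv).1
  have key : HasSum (fun n : ℕ => ∫ t in (0:ℝ)..1,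
      t ^ (b - 1) * (1 - t) ^ (c - b - 1) * (p n * (z * t) ^ n))
      (∫ t in (0:ℝ)..1, t ^ (b - 1) * (1 - t) ^ (c - b - 1) * (1 - z * t) ^ (-a)) := by
    have hs := (binom_hasSum a z hz).2
    apply intervalIntegral.hasSum_integral_of_dominated_convergence
      (fun n t => t ^ (b - 1) * (1 - t) ^ (c - b - 1) * (|p n| * |z| ^ n))
    · intro n
      exact Measurable.aestronglyMeasurable (by fun_prop)
    · refine fun n => .of_forall fun t ht => ?_
      rw [uIoc_of_le zero_le_one] at ht
      have h0 : 0 ≤ t ^ (b - 1) * (1 - t) ^ (c - b - 1) :=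
        mul_nonneg (rpow_nonneg ht.1.le _) (rpow_nonneg (by linarith [ht.2]) _)
      rw [norm_mul, Real.norm_of_nonneg h0, norm_mul, norm_pow, norm_mul, Real.norm_eq_abs,
        Real.norm_eq_abs, Real.norm_of_nonneg ht.1.le]
      have h1 : |z| * t ≤ |z| := mul_le_of_le_one_right (abs_nonneg z) ht.2
      have h2 : 0 ≤ |z| * t := mul_nonneg (abs_nonneg z) ht.1.le
      gcongr
    · exact .of_forall fun t _ => hs.mul_left _
    · simp_rw [tsum_mul_left]
      exact hint.mul_const _
    · refine .of_forall fun t ht => ?_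
      rw [uIoc_of_le zero_le_one] at ht
      refine ((binom_hasSum a (z * t) ?_).1).mul_left _
      rw [abs_mul, abs_of_pos ht.1]
      exact (mul_le_of_le_one_right (abs_nonneg z) ht.2).trans_lt hz
  have hterm : ∀ n : ℕ, ∫ t in (0:ℝ)..1,
      t ^ (b - 1) * (1 - t) ^ (c - b - 1) * (p n * (z * t) ^ n) =
      p n * z ^ n * (Real.Gamma (b + n) * Real.Gamma (c - b) / Real.Gamma (c + n)) := by
    intro n
    have := (beta_aux (b + n) (c - b) (by positivity) hv).2
    rw [show b + n + (c - b) = c + n by ring] at this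
    rw [← this, ← intervalIntegral.integral_const_mul]
    apply intervalIntegral.integral_congr_ae
    refine .of_forall fun t ht => ?_
    rw [uIoc_of_le zero_le_one] at ht
    rw [show b + n - 1 = (b - 1) + n by ring, rpow_add_natCast ht.1.ne']
    ring
  simp_rw [hterm] at key
  rw [hyp2F1, ← key.tsum_eq, ordinaryHypergeometric_eq_tsum, ← tsum_mul_left]
  refine tsum_congr fun n => ?_
  have hc : 0 < c := hb.trans hbc
  have hpos : 0 < (ascPochhammer ℝ n).eval c := ascPochhammer_pos n c hc
  rw [poch_eq b hb, poch_eq c hc, hp, smul_eq_mul]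
  have := Real.Gamma_pos_of_pos hb
  have := Real.Gamma_pos_of_pos hc
  have := Real.Gamma_pos_of_pos hv
  field_simp

theorem hyp2F1_pfaff (a b c z : ℝ) (hz : z < 1) :
    hyp2F1 a b c z = (1 - z) ^ (-a) * hyp2F1 a (c - b) c (z / (z - 1)) := by
  have h0 : 0 < 1 - z := sub_pos.2 hz
  rw [hyp2F1, hyp2F1, sub_sub_cancel, mul_left_comm,
    mul_comm (Real.Gamma b), ← intervalIntegral.integral_const_mul ((1 - z) ^ (-a))]
  congr 1
  have h := intervalIntegral.integral_comp_sub_left (a := 0) (b := 1)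
    (fun t : ℝ => t ^ (b - 1) * (1 - t) ^ (c - b - 1) * (1 - z * t) ^ (-a)) 1
  simp only [sub_zero, sub_self] at h
  rw [← h]
  apply intervalIntegral.integral_congr
  intro t ht
  rw [uIcc_of_le zero_le_one] at ht
  have h1 : 1 - z * (1 - t) = (1 - z) * (1 - z / (z - 1) * t) := by
    have : z - 1 ≠ 0 := by linarith
    field_simp
    ring
  have h2 : 0 ≤ 1 - z * (1 - t) := by nlinarith [ht.1, ht.2]
  have h3 : 0 ≤ 1 - z / (z - 1) * t := by
    rw [h1] at h2
    exact nonneg_of_mul_nonneg_right h2 h0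
  simp only [sub_sub_cancel]
  rw [h1, mul_rpow h0.le h3]
  ring

/-- The function is real-analytic on `(-∞, 1)`. -/
theorem hyp2F1_analyticOnNhd (a b c : ℝ) (ha : 0 < a) (hb : 0 < b) (hbc : b < c) :
    AnalyticOnNhd ℝ (hyp2F1 a b c) (Iio 1) := by
  have main : ∀ b' : ℝ, 0 < b' → b' < c → AnalyticOnNhd ℝ (hyp2F1 a b' c) (Ioo (-1) 1) := by
    intro b' hb' hbc' z hz
    have hr : (ordinaryHypergeometricSeries ℝ a b' c).radius = 1 := by
      apply ordinaryHypergeometricSeries_radius_eq_one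
      intro k
      have : (0:ℝ) ≤ k := k.cast_nonneg
      refine ⟨?_, ?_, ?_⟩ <;> linarith
    have h := (ordinaryHypergeometricSeries ℝ a b' c).hasFPowerSeriesOnBall (by simp [hr])
    have hm : z ∈ Metric.eball (0:ℝ) (ordinaryHypergeometricSeries ℝ a b' c).radius := by
      simpa [hr, enorm_eq_nnnorm, ← NNReal.coe_lt_coe] using abs_lt.2 hz
    refine (h.analyticAt_of_mem hm).congr ?_
    filter_upwards [Ioo_mem_nhds hz.1 hz.2] with y hy
    exact (hyp2F1_eq a b' c y hb' hbc' (abs_lt.2 hy)).symm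
  intro z hz
  have hz1 : z < 1 := hz
  rcases lt_or_ge (-1) z with h | h
  · exact main b hb hbc z ⟨h, hz⟩
  · have hw : z / (z - 1) ∈ Ioo (-1:ℝ) 1 := by
      have : z - 1 < 0 := by linarith
      constructor
      · rw [lt_div_iff_of_neg this]; linarith
      · rw [div_lt_iff_of_neg this]; linarith
    have h1 : AnalyticAt ℝ (fun y : ℝ => y / (y - 1)) z :=
      analyticAt_id.div (analyticAt_id.sub analyticAt_const) (by simp; linarith)
    have h2 : AnalyticAt ℝ (fun y : ℝ => (1 - y) ^ (-a)) z :=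
      
      ((contDiffAt_const.sub contDiffAt_id).rpow_const_of_ne
        (by simp; linarith) : ContDiffAt ℝ ⊤ _ z).analyticAt
    have h3 : AnalyticAt ℝ (fun y : ℝ => hyp2F1 a (c - b) c (y / (y - 1))) z :=
      AnalyticAt.fun_comp (f := fun y : ℝ => y / (y - 1)) (main (c - b) (sub_pos.2 hbc) (by linarith) _ hw) h1
    refine (h2.mul h3).congr ?_
    filter_upwards [Iio_mem_nhds hz1] with y hy
    exact (hyp2F1_pfaff a b c y hy).symm

/-- The hypergeometric function `𝒫_k(x) = ₂F₁(k/2, (k+1)/2; (2k+3)/2; -x²)`. -/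
noncomputable def hypP (k : ℕ) (x : ℝ) : ℝ :=
  hyp2F1 ((k : ℝ) / 2) (((k : ℝ) + 1) / 2) ((2 * (k : ℝ) + 3) / 2) (-x ^ 2)

/-- The hypergeometric function `𝒮_k(x) = ₂F₁(k/2, (k+1)/2; (2k+1)/2; -x²)`. -/
noncomputable def hypS (k : ℕ) (x : ℝ) : ℝ :=
  hyp2F1 ((k : ℝ) / 2) (((k : ℝ) + 1) / 2) ((2 * (k : ℝ) + 1) / 2) (-x ^ 2)

/-- The Legendre polynomial `P⁰_l`, by Rodrigues' formula. -/
noncomputable def legendreP0 (l : ℕ) (ξ : ℝ) : ℝ :=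
  1 / (2 ^ l * (l.factorial : ℝ)) * iteratedDeriv l (fun t : ℝ => (t ^ 2 - 1) ^ l) ξ

/-- The associated Legendre function `P¹_l(ξ) = (1 - ξ²)^{1/2} (d/dξ) P⁰_l(ξ)`. -/
noncomputable def legendreP1 (l : ℕ) (ξ : ℝ) : ℝ :=
  √(1 - ξ ^ 2) * deriv (legendreP0 l) ξ

/-- The term of order `ℓ ^ k`, `k ≥ 1`, in the expansion of the electric gauge function
`α = ∑_{k ≥ 1} ρ_k 𝒫_k(x) P⁰_k(ξ) (x ℓ)^k`, where `r = ℓ x`. -/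
noncomputable def alphaTerm (ρ : ℕ → ℝ) (ℓ : ℝ) (k : ℕ) (x ξ : ℝ) : ℝ :=
  ρ k * hypP k x * legendreP0 k ξ * (x * ℓ) ^ k

/-- The term of order `ℓ ^ k`, `k ≥ 2`, in the expansion of the magnetic gauge function
`ω = √(1 - ξ²) + ∑_{k ≥ 2} σ_k 𝒮_k(x) P¹_{k-1}(ξ) (x ℓ)^k`, where `r = ℓ x`. -/
noncomputable def omegaTerm (σ : ℕ → ℝ) (ℓ : ℝ) (k : ℕ) (x ξ : ℝ) : ℝ :=
  σ k * hypS k x * legendreP1 (k - 1) ξ * (x * ℓ) ^ k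

end AdSDyon

/-!
Everything is dominated by one series to which the ratio test applies.

*Hypergeometric factors.* In Euler's integral the factor `(1 + x² t) ^ (-k/2)` absorbs
`x ^ k * t ^ (k/2)`, because `x² t ≤ 1 + x² t`. What remains is a Beta integral independent of `x`,
and this gives
`|x ^ k * ₂F₁(k/2, (k+1)/2; c; -x²)| ≤ √π Γ(c) / (Γ((k+1)/2) Γ(c - k/2))`
(`abs_pow_mul_hyp2F1_le`). For the two values of `c` that occur, the right-hand side is at most a
constant times `2 ^ k` (`sqrt_pi_mul_Gamma_div_le`, by the functional equation of `Γ` in steps of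
two). This is where the threshold `1 / (2 ℓ)` comes from.

*Legendre factors.* Let `s = √(1 - ξ²)`. On the circle of radius `s` about `ξ` one has
`|z² - 1| ≤ 2 s` (`norm_sq_sub_one_le`), so Cauchy's estimate for the derivatives of `(z² - 1) ^ l`,
inserted in Rodrigues' formula, gives `|P⁰_l(ξ)| ≤ 1` and `s |(P⁰_l)'(ξ)| ≤ l + 1`.

Hence the terms of order `k` are at most `|ρ_k| (2 ℓ) ^ k (k + 1)` and `|σ_k| (2 ℓ) ^ k (k + 1)`
in absolute value, and both of these series converge by the ratio test
(`summable_mul_pow_mul_succ`).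
-/

namespace AdSDyon

/-! ### The hypergeometric factors -/

/-- The bound is uniform in `x`: it is Euler's prefactor times the Beta integral
`∫ t ^ (-1/2) * (1 - t) ^ (c - (k+1)/2 - 1)`. -/
theorem abs_pow_mul_hyp2F1_le (k : ℕ) (c x : ℝ) (hc : ((k : ℝ) + 1) / 2 < c) (hx : 0 ≤ x) :
    |x ^ k * hyp2F1 ((k : ℝ) / 2) (((k : ℝ) + 1) / 2) c (-x ^ 2)| ≤
      √π * Real.Gamma c / (Real.Gamma (((k : ℝ) + 1) / 2) * Real.Gamma (c - (k : ℝ) / 2)) := by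
  set b : ℝ := ((k : ℝ) + 1) / 2 with hb
  have hb0 : 0 < b := by positivity
  have hv : 0 < c - b := sub_pos.2 hc
  obtain ⟨hint, hval⟩ := beta_aux (1 / 2) (c - b) (by norm_num) hv
  rw [Real.Gamma_one_half_eq, show 1 / 2 + (c - b) = c - (k : ℝ) / 2 by rw [hb]; ring] at hval
  have hI : ‖∫ t in (0:ℝ)..1,
      x ^ k * (t ^ (b - 1) * (1 - t) ^ (c - b - 1) * (1 - -x ^ 2 * t) ^ (-((k : ℝ) / 2)))‖ ≤
      ∫ t in (0:ℝ)..1, t ^ ((1 / 2 : ℝ) - 1) * (1 - t) ^ (c - b - 1) := by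
    refine intervalIntegral.norm_integral_le_of_norm_le zero_le_one (.of_forall fun t ht => ?_) hint
    have ht0 : 0 < t := ht.1
    have ht1 : 0 ≤ 1 - t := sub_nonneg.2 ht.2
    have hpos : 0 < 1 + x ^ 2 * t := by positivity
    -- The exponent `b - 1` is `-1/2 + k/2`; the part `k/2` pairs with `x ^ k`.
    have hsplit : t ^ (b - 1) = t ^ ((1 / 2 : ℝ) - 1) * t ^ ((k : ℝ) / 2) := by
      rw [← rpow_add ht0, hb]; congr 1; ring
    have hxk : x ^ k = (x ^ 2) ^ ((k : ℝ) / 2) := by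
      rw [← rpow_natCast x 2, ← rpow_mul hx, ← rpow_natCast x k]
      congr 1; push_cast; ring
    have hle : x ^ k * t ^ ((k : ℝ) / 2) * (1 + x ^ 2 * t) ^ (-((k : ℝ) / 2)) ≤ 1 := by
      rw [hxk, ← mul_rpow (by positivity) ht0.le, rpow_neg hpos.le, ← div_eq_mul_inv]
      refine div_le_one_of_le₀ (rpow_le_rpow (by positivity) ?_ (by positivity)) (by positivity)
      linarith
    rw [show 1 - -x ^ 2 * t = 1 + x ^ 2 * t by ring, Real.norm_of_nonneg (by positivity), hsplit]
    calc _ = t ^ ((1 / 2 : ℝ) - 1) * (1 - t) ^ (c - b - 1) *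
          (x ^ k * t ^ ((k : ℝ) / 2) * (1 + x ^ 2 * t) ^ (-((k : ℝ) / 2))) := by ring
      _ ≤ _ := mul_le_of_le_one_right (by positivity) hle
  have hGb := Real.Gamma_pos_of_pos hb0
  have hGv := Real.Gamma_pos_of_pos hv
  have hGc := Real.Gamma_pos_of_pos (hb0.trans hc)
  rw [hval, intervalIntegral.integral_const_mul, Real.norm_eq_abs] at hI
  rw [hyp2F1, mul_left_comm, abs_mul, abs_of_pos (by positivity)]
  refine (mul_le_mul_of_nonneg_left hI (by positivity)).trans_eq ?_
  field_simp

/-- The value for `k + 2` is that for `k` times `4 (k + 1/2) (k + 3/2) / (k + 1) ^ 2 < 4`. -/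
theorem sqrt_pi_mul_Gamma_div_le (k : ℕ) :
    √π * Real.Gamma ((k : ℝ) + 1 / 2) / Real.Gamma (((k : ℝ) + 1) / 2) ^ 2 ≤ 2 ^ k := by
  induction k using Nat.twoStepInduction with
  | zero =>
    have : √π * √π = π := Real.mul_self_sqrt Real.pi_pos.le
    simp only [Nat.cast_zero, zero_add, Real.Gamma_one_half_eq, pow_zero, sq, this]
    exact (div_self Real.pi_ne_zero).le
  | one =>
    have h : √π * √π = π := Real.mul_self_sqrt Real.pi_pos.le
    have h1 : Real.Gamma ((1 : ℝ) + 1 / 2) = 1 / 2 * √π := by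
      rw [add_comm, Real.Gamma_add_one one_half_pos.ne', Real.Gamma_one_half_eq]
    rw [Nat.cast_one, h1, show ((1 : ℝ) + 1) / 2 = 1 by norm_num, Real.Gamma_one]
    linarith [Real.pi_le_four]
  | more k ih _ =>
    have e1 : Real.Gamma (((k + 2 : ℕ) : ℝ) + 1 / 2) =
        ((k : ℝ) + 3 / 2) * (((k : ℝ) + 1 / 2) * Real.Gamma ((k : ℝ) + 1 / 2)) := by
      rw [← Real.Gamma_add_one (by positivity),
        show (k : ℝ) + 1 / 2 + 1 = (k : ℝ) + 3 / 2 by ring, ← Real.Gamma_add_one (by positivity)]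
      congr 1; push_cast; ring
    have e2 : Real.Gamma ((((k + 2 : ℕ) : ℝ) + 1) / 2) =
        ((k : ℝ) + 1) / 2 * Real.Gamma (((k : ℝ) + 1) / 2) := by
      rw [← Real.Gamma_add_one (by positivity)]
      congr 1; push_cast; ring
    have hG : 0 < Real.Gamma (((k : ℝ) + 1) / 2) := Real.Gamma_pos_of_pos (by positivity)
    have hG' : 0 < Real.Gamma ((k : ℝ) + 1 / 2) := Real.Gamma_pos_of_pos (by positivity)
    have hr : 4 * ((k : ℝ) + 3 / 2) * ((k : ℝ) + 1 / 2) / ((k : ℝ) + 1) ^ 2 ≤ 4 := by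
      rw [div_le_iff₀ (by positivity)]
      nlinarith
    rw [e1, e2]
    calc _ = 4 * ((k : ℝ) + 3 / 2) * ((k : ℝ) + 1 / 2) / ((k : ℝ) + 1) ^ 2 *
          (√π * Real.Gamma ((k : ℝ) + 1 / 2) / Real.Gamma (((k : ℝ) + 1) / 2) ^ 2) := by
          field_simp
          norm_num
      _ ≤ 4 * 2 ^ k := by gcongr
      _ = 2 ^ (k + 2) := by ring

theorem abs_pow_mul_hypS_le (k : ℕ) (hk : k ≠ 0) (x : ℝ) (hx : 0 ≤ x) :
    |x ^ k * hypS k x| ≤ 2 ^ k := by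
  have hk' : (0 : ℝ) < k := by positivity
  have h := abs_pow_mul_hyp2F1_le k ((2 * (k : ℝ) + 1) / 2) x (by linarith) hx
  refine h.trans (le_of_eq_of_le ?_ (sqrt_pi_mul_Gamma_div_le k))
  rw [show (2 * (k : ℝ) + 1) / 2 = (k : ℝ) + 1 / 2 by ring,
    show (k : ℝ) + 1 / 2 - (k : ℝ) / 2 = ((k : ℝ) + 1) / 2 by ring, sq]

theorem abs_pow_mul_hypP_le (k : ℕ) (x : ℝ) (hx : 0 ≤ x) :
    |x ^ k * hypP k x| ≤ 2 * 2 ^ k := by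
  have hk : (0 : ℝ) ≤ k := k.cast_nonneg
  have h := abs_pow_mul_hyp2F1_le k ((2 * (k : ℝ) + 3) / 2) x (by linarith) hx
  have e1 : Real.Gamma ((2 * (k : ℝ) + 3) / 2) =
      ((k : ℝ) + 1 / 2) * Real.Gamma ((k : ℝ) + 1 / 2) := by
    rw [← Real.Gamma_add_one (by positivity)]
    congr 1; ring
  have e2 : Real.Gamma ((2 * (k : ℝ) + 3) / 2 - (k : ℝ) / 2) =
      ((k : ℝ) + 1) / 2 * Real.Gamma (((k : ℝ) + 1) / 2) := by
    rw [← Real.Gamma_add_one (by positivity)]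
    congr 1; ring
  have hG : 0 < Real.Gamma (((k : ℝ) + 1) / 2) := Real.Gamma_pos_of_pos (by positivity)
  have hG' : 0 < Real.Gamma ((k : ℝ) + 1 / 2) := Real.Gamma_pos_of_pos (by positivity)
  have hr : (2 * (k : ℝ) + 1) / ((k : ℝ) + 1) ≤ 2 := by
    rw [div_le_iff₀ (by positivity)]
    linarith
  rw [e1, e2] at h
  calc _ ≤ _ := h
    _ = (2 * (k : ℝ) + 1) / ((k : ℝ) + 1) *
          (√π * Real.Gamma ((k : ℝ) + 1 / 2) / Real.Gamma (((k : ℝ) + 1) / 2) ^ 2) := by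
        field_simp
    _ ≤ 2 * 2 ^ k := by
        gcongr
        exact sqrt_pi_mul_Gamma_div_le k

/-! ### The Legendre factors -/

/-- With `z = ξ + w` and `|w|² = s² = 1 - ξ²`, one has `z² - 1 = w (2 ξ + w - conj w)`, and
`w - conj w` is purely imaginary of modulus at most `2 s`. -/
theorem norm_sq_sub_one_le (ξ s : ℝ) (hs : s ^ 2 = 1 - ξ ^ 2) (hs0 : 0 ≤ s) (z : ℂ)
    (hz : z ∈ Metric.sphere (ξ : ℂ) s) : ‖z ^ 2 - 1‖ ≤ 2 * s := by
  rw [mem_sphere_iff_norm] at hz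
  have hw : z ^ 2 - 1 = (z - ξ) * ((2 * ξ : ℝ) + (2 * z.im : ℝ) * Complex.I) := by
    have h1 : (z.re - ξ) ^ 2 + z.im ^ 2 = s ^ 2 := by
      rw [← hz, Complex.sq_norm, Complex.normSq_apply]
      simp
      ring
    apply Complex.ext
    · simp [sq]
      linarith
    · simp [sq]
      ring
  have him : z.im ^ 2 ≤ s ^ 2 := by
    have := Complex.abs_im_le_norm (z - ξ)
    rw [hz] at this
    simpa using sq_le_sq' (abs_le.1 this).1 (abs_le.1 this).2
  have h2 : ‖((2 * ξ : ℝ) + (2 * z.im : ℝ) * Complex.I : ℂ)‖ ≤ 2 := by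
    rw [Complex.norm_add_mul_I]
    exact Real.sqrt_le_iff.2 ⟨by norm_num, by linarith⟩
  rw [hw, norm_mul, hz, mul_comm 2 s]
  exact mul_le_mul_of_nonneg_left h2 hs0

theorem iteratedDeriv_polynomial_eval {𝕜 : Type*} [NontriviallyNormedField 𝕜] (n : ℕ)
    (p : Polynomial 𝕜) :
    iteratedDeriv n (fun t => p.eval t) = fun t => (Polynomial.derivative^[n] p).eval t := by
  induction n with
  | zero => simp
  | succ n ih =>
    rw [iteratedDeriv_succ, ih]
    funext t
    rw [Polynomial.deriv, Function.iterate_succ_apply']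

/-- The real derivatives in Rodrigues' formula are complex ones, so Cauchy's estimate applies. -/
theorem ofReal_iteratedDeriv_sq_sub_one_pow (n l : ℕ) (ξ : ℝ) :
    ((iteratedDeriv n (fun t : ℝ => (t ^ 2 - 1) ^ l) ξ : ℝ) : ℂ) =
      iteratedDeriv n (fun z : ℂ => (z ^ 2 - 1) ^ l) ξ := by
  have hr := iteratedDeriv_polynomial_eval n ((Polynomial.X ^ 2 - 1 : Polynomial ℝ) ^ l)
  have hc := iteratedDeriv_polynomial_eval n
    (((Polynomial.X ^ 2 - 1 : Polynomial ℝ) ^ l).map Complex.ofRealHom)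
  rw [Polynomial.iterate_derivative_map] at hc
  simp only [Polynomial.eval_pow, Polynomial.eval_sub, Polynomial.eval_X, Polynomial.eval_one,
    Polynomial.map_pow, Polynomial.map_sub, Polynomial.map_X, Polynomial.map_one] at hr hc
  rw [hr, hc]
  beta_reduce
  rw [Polynomial.eval_map]
  exact (Polynomial.eval₂_at_apply Complex.ofRealHom ξ).symm

/-- Cauchy's estimate on the circle of radius `√(1 - ξ²)` about `ξ`. -/
theorem abs_iteratedDeriv_sq_sub_one_pow_le (n l : ℕ) (ξ : ℝ) (hξ : ξ ∈ Ioo (-1 : ℝ) 1) :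
    |iteratedDeriv n (fun t : ℝ => (t ^ 2 - 1) ^ l) ξ| ≤
      n.factorial * (2 * √(1 - ξ ^ 2)) ^ l / √(1 - ξ ^ 2) ^ n := by
  have h1 : 0 < 1 - ξ ^ 2 := by nlinarith [hξ.1, hξ.2]
  rw [← Real.norm_eq_abs, ← Complex.norm_real, ofReal_iteratedDeriv_sq_sub_one_pow]
  refine Complex.norm_iteratedDeriv_le_of_forall_mem_sphere_norm_le n (Real.sqrt_pos.2 h1)
    (Differentiable.diffContOnCl (by fun_prop)) fun z hz => ?_
  rw [norm_pow]
  exact pow_le_pow_left₀ (norm_nonneg _)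
    (norm_sq_sub_one_le ξ _ (Real.sq_sqrt h1.le) (Real.sqrt_nonneg _) z hz) l

theorem continuous_legendreP0 (l : ℕ) : Continuous (legendreP0 l) := by
  have : ContDiff ℝ l (fun t : ℝ => (t ^ 2 - 1) ^ l) := by fun_prop
  exact continuous_const.mul (this.continuous_iteratedDeriv l le_rfl)

theorem abs_legendreP0_le_one (l : ℕ) (ξ : ℝ) (hξ : ξ ∈ Icc (-1 : ℝ) 1) :
    |legendreP0 l ξ| ≤ 1 := by
  have hopen : Ioo (-1 : ℝ) 1 ⊆ {t | |legendreP0 l t| ≤ 1} := by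
    intro t ht
    have hs : 0 < √(1 - t ^ 2) := Real.sqrt_pos.2 (by nlinarith [ht.1, ht.2])
    rw [mem_ofPred_eq, legendreP0, abs_mul, abs_of_pos (by positivity)]
    refine (mul_le_mul_of_nonneg_left (abs_iteratedDeriv_sq_sub_one_pow_le l l t ht)
      (by positivity)).trans_eq ?_
    rw [mul_pow]
    field_simp
  -- At the endpoints the circle degenerates; the bound extends by continuity.
  have hclosed : IsClosed {t | |legendreP0 l t| ≤ 1} :=
    isClosed_le (continuous_legendreP0 l).abs continuous_const
  rw [← closure_Ioo (by norm_num)] at hξ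
  exact closure_minimal hopen hclosed hξ

theorem abs_legendreP1_le (l : ℕ) (ξ : ℝ) (hξ : ξ ∈ Icc (-1 : ℝ) 1) :
    |legendreP1 l ξ| ≤ l + 1 := by
  rcases (show 0 ≤ 1 - ξ ^ 2 by nlinarith [hξ.1, hξ.2]).eq_or_lt with h0 | h0
  · rw [legendreP1, ← h0, Real.sqrt_zero, zero_mul, abs_zero]
    positivity
  · have hs : 0 < √(1 - ξ ^ 2) := Real.sqrt_pos.2 h0
    have hd : deriv (legendreP0 l) ξ = 1 / (2 ^ l * (l.factorial : ℝ)) *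
        iteratedDeriv (l + 1) (fun t : ℝ => (t ^ 2 - 1) ^ l) ξ := by
      rw [iteratedDeriv_succ, ← deriv_const_mul_field]
      rfl
    have hξ' : ξ ∈ Ioo (-1 : ℝ) 1 := abs_lt.1 ((sq_lt_one_iff_abs_lt_one ξ).1 (by linarith))
    rw [legendreP1, hd, abs_mul, abs_mul, abs_of_pos hs, abs_of_pos (by positivity)]
    refine (mul_le_mul_of_nonneg_left (mul_le_mul_of_nonneg_left
      (abs_iteratedDeriv_sq_sub_one_pow_le (l + 1) l ξ hξ') (by positivity)) hs.le).trans_eq ?_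
    rw [Nat.factorial_succ, mul_pow]
    push_cast
    field_simp
    ring

/-! ### The dominating series -/

theorem summable_mul_pow_mul_succ (τ : ℕ → ℝ) (q L : ℝ) (hq : 0 < q)
    (hτ0 : ∀ᶠ k in atTop, τ k ≠ 0)
    (hτ : Tendsto (fun k : ℕ => |τ (k + 1) / τ k|) atTop (𝓝 L)) (hL : L * q < 1) :
    Summable (fun k : ℕ => |τ k| * q ^ k * ((k : ℝ) + 1)) := by
  refine summable_of_ratio_test_tendsto_lt_one hL ?_ ?_
  · filter_upwards [hτ0] with k hk
    positivity
  · have h := (hτ.mul_const q).mul (tendsto_add_mul_div_add_mul_atTop_nhds (2 : ℝ) 1 1 one_ne_zero)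
    rw [div_one, mul_one] at h
    refine h.congr' ?_
    filter_upwards [hτ0] with k hk
    rw [Real.norm_of_nonneg (by positivity), Real.norm_of_nonneg (by positivity), abs_div]
    have : |τ k| ≠ 0 := abs_ne_zero.2 hk
    push_cast
    field_simp
    ring

end AdSDyon

theorem mainTheorem3 (ℓ : ℝ) (hℓ : 0 < ℓ) (ρ σ : ℕ → ℝ)
    (hρ0 : ∀ᶠ k in atTop, ρ k ≠ 0) (hσ0 : ∀ᶠ k in atTop, σ k ≠ 0)
    (Lρ Lσ : ℝ)
    (hσ : Tendsto (fun k : ℕ => |σ (k + 1) / σ k|) atTop (𝓝 Lσ)) (hLσ : Lσ < 1 / (2 * ℓ))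
    (hρ : Tendsto (fun k : ℕ => |ρ (k + 1) / ρ k|) atTop (𝓝 Lρ)) (hLρ : Lρ < 1 / (2 * ℓ)) :
    ∀ x : ℝ, 0 ≤ x → ∀ ξ ∈ Icc (-1 : ℝ) 1,
      Summable (fun k : ℕ => AdSDyon.alphaTerm ρ ℓ (k + 1) x ξ) ∧
      Summable (fun k : ℕ => AdSDyon.omegaTerm σ ℓ (k + 2) x ξ) := by
  intro x hx ξ hξ
  have hq : 0 < 2 * ℓ := by positivity
  have hsρ := AdSDyon.summable_mul_pow_mul_succ ρ (2 * ℓ) Lρ hq hρ0 hρ ((lt_div_iff₀ hq).1 hLρ)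
  have hsσ := AdSDyon.summable_mul_pow_mul_succ σ (2 * ℓ) Lσ hq hσ0 hσ ((lt_div_iff₀ hq).1 hLσ)
  constructor
  · refine ((summable_nat_add_iff 1).2 hsρ).of_norm_bounded fun k => ?_
    have hP := AdSDyon.abs_pow_mul_hypP_le (k + 1) x hx
    have hL := AdSDyon.abs_legendreP0_le_one (k + 1) ξ hξ
    have hk : (2 : ℝ) ≤ ((k + 1 : ℕ) : ℝ) + 1 := by
      push_cast
      linarith [(k.cast_nonneg : (0 : ℝ) ≤ k)]
    calc ‖AdSDyon.alphaTerm ρ ℓ (k + 1) x ξ‖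
        = |ρ (k + 1)| * ℓ ^ (k + 1) * (|x ^ (k + 1) * AdSDyon.hypP (k + 1) x| *
            |AdSDyon.legendreP0 (k + 1) ξ|) := by
          rw [← abs_of_pos (pow_pos hℓ (k + 1)), ← abs_mul, ← abs_mul, ← abs_mul,
            Real.norm_eq_abs, AdSDyon.alphaTerm, mul_pow]
          congr 1
          ring
      _ ≤ |ρ (k + 1)| * ℓ ^ (k + 1) * (2 * 2 ^ (k + 1) * 1) := by gcongr
      _ = |ρ (k + 1)| * (2 * ℓ) ^ (k + 1) * 2 := by ring
      _ ≤ _ := by gcongr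
  · refine ((summable_nat_add_iff 2).2 hsσ).of_norm_bounded fun k => ?_
    have hS := AdSDyon.abs_pow_mul_hypS_le (k + 2) (by positivity) x hx
    have hL : |AdSDyon.legendreP1 (k + 2 - 1) ξ| ≤ ((k + 2 : ℕ) : ℝ) + 1 := by
      have := AdSDyon.abs_legendreP1_le (k + 2 - 1) ξ hξ
      have hk : ((k + 2 - 1 : ℕ) : ℝ) ≤ ((k + 2 : ℕ) : ℝ) := by
        exact_mod_cast Nat.sub_le _ _
      linarith
    calc ‖AdSDyon.omegaTerm σ ℓ (k + 2) x ξ‖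
        = |σ (k + 2)| * ℓ ^ (k + 2) * (|x ^ (k + 2) * AdSDyon.hypS (k + 2) x| *
            |AdSDyon.legendreP1 (k + 2 - 1) ξ|) := by
          rw [← abs_of_pos (pow_pos hℓ (k + 2)), ← abs_mul, ← abs_mul, ← abs_mul,
            Real.norm_eq_abs, AdSDyon.omegaTerm, mul_pow]
          congr 1
          ring
      _ ≤ |σ (k + 2)| * ℓ ^ (k + 2) * (2 ^ (k + 2) * (((k + 2 : ℕ) : ℝ) + 1)) := by gcongr
      _ = _ := by ring
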